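/- Fix $d\in\mathbb N$. Two miners play a sequence of mining races; $p_1,p_2>0$, $p_1+p_2=1$. A state is a pair $(\ell_1,\ell_2)\in\{0,\dots,d\}^2$ (the lengths of the two players' branches above the last common block). Each player $i$ has a capitulation policy $(C_i,s_i)$ with $C_i:\{0,\dots,d\}^2\to\{0,1\}$ and $s_i\in\{0,\dots,d\}$. Write $-i$ for the opponent of $i$. If player $1$ wins the race at state $(\ell_1,\ell_2)$, the next state is $(s_2,0)$ if $C_2(\ell_1,\ell_2)=1$ (player $2$ capitulates) and $(\ell_1+1,\ell_2)$ otherwise; if player $2$ wins, it is $(0,s_1)$ if $C_1(\ell_1,\ell_2)=1$ and $(\ell_1,\ell_2+1)$ otherwise. Let $\mathcal M$ be the set of states reachable from $(0,s_1)$ and $(s_2,0)$. The policies are assumed feasible: for every $(\ell_1,\ell_2)\in\mathcal M$ and $i\in\{1,2\}$, $\ell_i=d$ implies $C_{-i}(\ell_1,\ell_2)=1$, and $C_{-i}(\ell_1,\ell_2)=1$ implies $s_{-i}\le \ell_i$. Let $\mu$ be any probability distribution on $\mathcal M$. Let $X_0\sim\mu$, let the winners $\omega_0,\omega_1,\dots$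 be i.i.d. with $\mathbb P(\omega_n=i)=p_i$, and let the turn lengths $\tau_0,\tau_1,\dots$ be i.i.d. exponential with some rate $\lambda>0$, all of these being independent; let $X_{n+1}$ be the state reached from $X_n$ when $\omega_n$ wins the race. Write $\mathbb E_\mu$ for the expectation and $P$ for the transition matrix of $(X_n)$. Let $r_{i,n}=\ell_i+1-s_{-i}$ if $X_n=(\ell_1,\ell_2)$, $\omega_n=i$ and $C_{-i}(X_n)=1$, and $r_{i,n}=0$ otherwise (the number of blocks of player $i$ validated at turn $n$), and let $\delta_n=r_{1,n}+r_{2,n}$. Let $\hat r_i(\ell_1,\ell_2)=p_i(\ell_i+1-s_{-i})$ if $C_{-i}(\ell_1,\ell_2)=1$ and $\hat r_i(\ell_1,\ell_2)=0$ otherwise. Then $P$ has a unique stationary distribution $\pi_P$ on $\mathcal M$, and for every initial distribution $\mu$ the limits $$\delta=\lim_{n\to\infty}\frac1n\,\mathbb E_\mu\Big(1+\sum_{k=1}^{n}\delta_k\Big),\qquad G_i=\lim_{n\to\infty}\mathbb E_\mu\left(\frac{\sum_{k=0}^{n-1}r_{i,k}}{1+\sum_{k=0}^{n-1}\delta_k}\right)\quad(i=1,2)$$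 exist, $\delta>0$, and $$\delta=\langle\pi_P,\hat r_1+\hat r_2\rangle,\qquad G_i=\frac{\langle\pi_P,\hat r_i\rangle}{\delta}.$$ If moreover the difficulty is adjusted to a target $\overline\tau$, i.e. $\lim_{n\to\infty}\mathbb E_\mu\Big(\frac{\sum_{k=0}^{n-1}\tau_k}{1+\sum_{k=0}^{n-1}\delta_k}\Big)=\overline\tau$, then for all costs $c_1,c_2\ge0$ the limits $R_i=\lim_{n\to\infty}\frac1n\mathbb E_\mu\big(\sum_{k=0}^{n-1}(r_{i,k}-c_i\tau_k)\big)$ exist and $$R_i=\delta\,(G_i-c_i\overline\tau)=\langle\pi_P,\hat r_i\rangle-c_i\overline\tau\,\delta\qquad(i=1,2).$$ -/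

import Mathlib

open MeasureTheory ProbabilityTheory Filter Topology Matrix

namespace MiningGame

/-- A state `(ℓ₁, ℓ₂) ∈ {0, …, d}²`: the lengths of the branches of players 1 and 2 that grow
from the last common (validated) block. Player 1 is `0 : Fin 2` and player 2 is `1 : Fin 2`. -/
abbrev State (d : ℕ) : Type := Fin (d + 1) × Fin (d + 1)

/-- A capitulation policy `(C, s)`. If a turn starts at `m` and the player loses the mining race,
the player capitulates when `C m = 1` (here `true`) and continues the own branch when `C m = 0`.
After a capitulation the player has to surpass `s` blocks of the opponent. -/
structure CapitulationPolicy (d : ℕ) where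
  C : State d → Bool
  s : Fin (d + 1)

/-- The opponent of a player. -/
def opp (i : Fin 2) : Fin 2 := 1 - i

/-- The length of the branch of player `i`. -/
def branch {d : ℕ} (i : Fin 2) (m : State d) : Fin (d + 1) := if i = 0 then m.1 else m.2

/-- The state to which the game is reset when player `i` has won a round:
`(s₂, 0)` if player 1 won it (player 2 capitulates), `(0, s₁)` if player 2 won it. -/
def resetState {d : ℕ} (σ : Fin 2 → CapitulationPolicy d) (i : Fin 2) : State d :=
  if i = 0 then ((σ 1).s, 0) else (0, (σ 0).s)

/-- The state reached from `m` when player `w` wins the mining race. The opponent of `w` either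
capitulates, or the branch of `w` grows by one block. (The addition is in `Fin (d + 1)`; for
feasible policies it never wraps around, because the opponent capitulates at length `d`.) -/
def step {d : ℕ} (σ : Fin 2 → CapitulationPolicy d) (m : State d) (w : Fin 2) : State d :=
  if (σ (opp w)).C m = true then resetState σ w
  else if w = 0 then (m.1 + 1, m.2) else (m.1, m.2 + 1)

/-- The states reachable from the two initial states `(s₂, 0)` and `(0, s₁)`. -/
inductive Reachable {d : ℕ} (σ : Fin 2 → CapitulationPolicy d) : State d → Prop
  | reset (i : Fin 2) : Reachable σ (resetState σ i)
  | step (m : State d) (w : Fin 2) : Reachable σ m → Reachable σ (MiningGame.step σ m w)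

/-- The state space `𝓜` of the chain. -/
abbrev StateSpace {d : ℕ} (σ : Fin 2 → CapitulationPolicy d) : Type :=
  {m : State d // Reachable σ m}

noncomputable instance {d : ℕ} (σ : Fin 2 → CapitulationPolicy d) :
    DecidablePred (Reachable σ) := Classical.decPred _

/-- Feasibility of a pair of policies, required at the states that can occur:
(i) no branch gets longer than the maximum depth `d`: when the branch of `i` has length `d`
and `i` wins the next race, the opponent recognizes it, i.e. capitulates;
(ii) a player who capitulates selects a block of the opponent's branch, which then has length
`ℓ + 1`, so that at most `ℓ` blocks are left to surpass. -/
def Feasible {d : ℕ} (σ : Fin 2 → CapitulationPolicy d) : Prop :=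
  ∀ m, Reachable σ m → ∀ i : Fin 2,
    (branch i m = Fin.last d → (σ (opp i)).C m = true) ∧
    ((σ (opp i)).C m = true → (σ (opp i)).s ≤ branch i m)

/-- One transition of the chain, on the state space. -/
def next {d : ℕ} (σ : Fin 2 → CapitulationPolicy d) (m : StateSpace σ) (w : Fin 2) :
    StateSpace σ := ⟨step σ m.1 w, Reachable.step m.1 w m.2⟩

/-- The transition matrix `P`, player `w` winning the mining race with probability `p w`. -/
noncomputable def transitionMatrix {d : ℕ} (σ : Fin 2 → CapitulationPolicy d) (p : Fin 2 → ℝ) :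
    Matrix (StateSpace σ) (StateSpace σ) ℝ :=
  fun m m' => ∑ w : Fin 2, if next σ m w = m' then p w else 0

/-- `π` is a stationary distribution of `(𝓜, P)`. -/
def IsStationary {d : ℕ} (σ : Fin 2 → CapitulationPolicy d) (p : Fin 2 → ℝ)
    (π : StateSpace σ → ℝ) : Prop :=
  π ∈ stdSimplex ℝ (StateSpace σ) ∧ π ᵥ* transitionMatrix σ p = π

/-- The boundary `∂ᵢ𝓜`: the states at which player `i` wins the round if `i` wins the race. -/
def boundary {d : ℕ} (σ : Fin 2 → CapitulationPolicy d) (i : Fin 2) : Set (StateSpace σ) :=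
  {m | (σ (opp i)).C m.1 = true}

open Classical in
/-- The number of blocks of player `i` that are validated in the transition that leaves `m` when
`w` wins the race: it is `ℓᵢ + 1 - s₋ᵢ` if `w = i` and the opponent capitulates, else `0`. -/
noncomputable def reward {d : ℕ} (σ : Fin 2 → CapitulationPolicy d) (i : Fin 2)
    (m : StateSpace σ) (w : Fin 2) : ℝ :=
  if w = i ∧ m ∈ boundary σ i then ((branch i m.1 : ℕ) : ℝ) + 1 - (((σ (opp i)).s : ℕ) : ℝ)
  else 0

open Classical in
/-- The vector `r̂ᵢ`: `pᵢ (ℓᵢ + 1 - s₋ᵢ)` on `∂ᵢ𝓜` and `0` elsewhere. -/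
noncomputable def rhat {d : ℕ} (σ : Fin 2 → CapitulationPolicy d) (p : Fin 2 → ℝ) (i : Fin 2)
    (m : StateSpace σ) : ℝ :=
  if m ∈ boundary σ i then p i * (((branch i m.1 : ℕ) : ℝ) + 1 - (((σ (opp i)).s : ℕ) : ℝ))
  else 0

/-- The outcomes `(ωₙ, tₙ)ₙ`: the winner and the length of the mining race of each turn. -/
abbrev Races : Type := ℕ → Fin 2 × ℝ

/-- The law `ℙ₀` of the races: all winners and all lengths are independent, a winner is `i` with
probability `p i`, a length is exponential with rate `lam`. -/
noncomputable def raceLaw (p : Fin 2 → ℝ) (lam : ℝ) : Measure Races :=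
  Measure.infinitePi fun _ : ℕ =>
    (∑ i : Fin 2, ENNReal.ofReal (p i) • Measure.dirac i).prod (expMeasure lam)

/-- The law `ℙ_μ = μ × ℙ₀` on `Ω = 𝓜 × Ω₀`. -/
noncomputable def gameLaw {d : ℕ} (σ : Fin 2 → CapitulationPolicy d) (p : Fin 2 → ℝ) (lam : ℝ)
    (μ : Measure (StateSpace σ)) : Measure (StateSpace σ × Races) :=
  μ.prod (raceLaw p lam)

/-- The chain `Xₙ`. -/
def X {d : ℕ} (σ : Fin 2 → CapitulationPolicy d) : ℕ → StateSpace σ × Races → StateSpace σ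
  | 0, ω => ω.1
  | n + 1, ω => next σ (X σ n ω) (ω.2 n).1

/-- `r_{i,n}`: the number of blocks of player `i` validated at turn `n`. -/
noncomputable def blocks {d : ℕ} (σ : Fin 2 → CapitulationPolicy d) (i : Fin 2) (n : ℕ)
    (ω : StateSpace σ × Races) : ℝ :=
  reward σ i (X σ n ω) (ω.2 n).1

/-- `δₙ`: the number of all blocks validated at turn `n`. -/
noncomputable def validated {d : ℕ} (σ : Fin 2 → CapitulationPolicy d) (n : ℕ)
    (ω : StateSpace σ × Races) : ℝ :=
  ∑ i : Fin 2, blocks σ i n ω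

/-- `τₙ`: the length of turn `n`. -/
def turnLength {d : ℕ} (σ : Fin 2 → CapitulationPolicy d) (n : ℕ)
    (ω : StateSpace σ × Races) : ℝ := (ω.2 n).2

/-- `δ` is the asymptotic rate of validated blocks, started from `μ`. -/
def IsValidationRate {d : ℕ} (σ : Fin 2 → CapitulationPolicy d) (p : Fin 2 → ℝ) (lam : ℝ)
    (μ : Measure (StateSpace σ)) (δ : ℝ) : Prop :=
  Tendsto (fun n : ℕ => (1 / (n : ℝ)) *
    ∫ ω, (1 + ∑ k ∈ Finset.Icc 1 n, validated σ k ω) ∂(gameLaw σ p lam μ)) atTop (𝓝 δ)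

/-- `G` is the asymptotic ratio `Gᵢ` of validated blocks owned by player `i`. -/
def IsBlockRatio {d : ℕ} (σ : Fin 2 → CapitulationPolicy d) (p : Fin 2 → ℝ) (lam : ℝ)
    (μ : Measure (StateSpace σ)) (i : Fin 2) (G : ℝ) : Prop :=
  Tendsto (fun n : ℕ =>
    ∫ ω, (∑ k ∈ Finset.range n, blocks σ i k ω) / (1 + ∑ k ∈ Finset.range n, validated σ k ω)
      ∂(gameLaw σ p lam μ)) atTop (𝓝 G)

/-- `R` is the asymptotic revenue per turn `Rᵢ` of player `i`, with cost `ci` per time unit. -/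
def IsRevenue {d : ℕ} (σ : Fin 2 → CapitulationPolicy d) (p : Fin 2 → ℝ) (lam : ℝ)
    (μ : Measure (StateSpace σ)) (ci : ℝ) (i : Fin 2) (R : ℝ) : Prop :=
  Tendsto (fun n : ℕ => (1 / (n : ℝ)) *
    ∫ ω, (∑ k ∈ Finset.range n, (blocks σ i k ω - ci * turnLength σ k ω))
      ∂(gameLaw σ p lam μ)) atTop (𝓝 R)

/-- The difficulty adjustment: the expected time per validated block tends to the target `τbar`. -/
def DifficultyAdjusted {d : ℕ} (σ : Fin 2 → CapitulationPolicy d) (p : Fin 2 → ℝ) (lam : ℝ)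
    (μ : Measure (StateSpace σ)) (τbar : ℝ) : Prop :=
  Tendsto (fun n : ℕ =>
    ∫ ω, (∑ k ∈ Finset.range n, turnLength σ k ω) / (1 + ∑ k ∈ Finset.range n, validated σ k ω)
      ∂(gameLaw σ p lam μ)) atTop (𝓝 τbar)

end MiningGame

namespace MiningGame

/-! If player 1 keeps winning, the first branch grows until player 2 capitulates, which feasibility
forces at length `d` at the latest, and the game resets to `(s₂, 0)`. This one state, accessible
from everywhere, replaces irreducibility: harmonic functions are constant, so by rank-nullity the
Poisson equation `h - P h = f - ⟨π, f⟩` is solvable (`exists_poisson`). Uniqueness of `π` follows.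
Aperiodicity plays no role, since only averages occur.

The Poisson solution writes a sum of rewards over `n` turns as `n ⟨π, f⟩` plus a martingale with
bounded increments plus a bounded error. The variance of the martingale gives an `L¹` law of large
numbers with error `O(√n)`. This settles `δ` and also `Gᵢ`, whose ratio is bounded by 1.

The expected time per block is harder, because `n / (1 + ∑ δₖ)` can be as large as `n`. Exponential
moments of the martingale show that few validated blocks are exponentially unlikely, so its mean
tends to `1 / δ` (`tendsto_integral_inv_validated`). Lengths are independent of winners, so the
difficulty condition forces `τbar` to be the mean length divided by `δ`; the cost per turn is then
`cᵢ τbar δ`. -/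

variable {d : ℕ} {σ : Fin 2 → CapitulationPolicy d} {p : Fin 2 → ℝ} {lam : ℝ}

/-! ### Accessibility of the reset state -/

/-- A nonempty set of states closed under races won by player 1 contains a state at which
player 2 capitulates. -/
theorem exists_mem_boundary_of_closed (hσ : Feasible σ) (S : Set (StateSpace σ))
    (hS : ∀ m ∈ S, next σ m 0 ∈ S) (hne : S.Nonempty) : ∃ m ∈ S, m ∈ boundary σ 0 := by
  obtain ⟨m, hm⟩ := hne
  -- The induction runs on the room left in the first branch: no room forces capitulation, and with
  -- room left the `Fin` addition does not wrap around.
  induction hk : d - (m.1.1 : ℕ) generalizing m with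
  | zero =>
    refine ⟨m, hm, (hσ m.1 m.2 0).1 ?_⟩
    have := m.1.1.2
    apply Fin.ext
    simp only [branch, if_true, Fin.val_last]
    omega
  | succ k ih =>
    by_cases hb : m ∈ boundary σ 0
    · exact ⟨m, hm, hb⟩
    · refine ih (next σ m 0) (hS m hm) ?_
      have hb' : ¬ (σ (opp 0)).C m.1 = true := hb
      have h1 : (next σ m 0).1.1 = m.1.1 + 1 := by simp [next, step, hb']
      have hlt : m.1.1 < Fin.last d := by
        rw [Fin.lt_def, Fin.val_last]; omega
      rw [h1, Fin.val_add_one_of_lt hlt]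
      omega

/-- A win of player 1 at a boundary state leads to the reset state. Used in place of irreducibility.
-/
theorem reset_mem_of_closed (hσ : Feasible σ) (S : Set (StateSpace σ))
    (hS : ∀ m ∈ S, next σ m 0 ∈ S) (hne : S.Nonempty) :
    (⟨resetState σ 0, Reachable.reset 0⟩ : StateSpace σ) ∈ S := by
  obtain ⟨m, hm, hb⟩ := exists_mem_boundary_of_closed hσ S hS hne
  have h := hS m hm
  have hb' : (σ (opp 0)).C m.1 = true := hb
  have e : next σ m 0 = ⟨resetState σ 0, Reachable.reset 0⟩ := by
    apply Subtype.ext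
    simp [next, step, hb']
  rwa [e] at h

/-! ### Harmonic functions, stationary distribution, Poisson equation -/

instance : Nonempty (StateSpace σ) := ⟨⟨resetState σ 0, Reachable.reset 0⟩⟩

theorem transitionMatrix_mulVec (f : StateSpace σ → ℝ) (m : StateSpace σ) :
    (transitionMatrix σ p *ᵥ f) m = ∑ w, p w * f (next σ m w) := by
  simp only [mulVec, dotProduct, transitionMatrix, Finset.sum_mul]
  rw [Finset.sum_comm]
  simp [ite_mul]

theorem vecMul_transitionMatrix (v : StateSpace σ → ℝ) (m' : StateSpace σ) :
    (v ᵥ* transitionMatrix σ p) m' = ∑ m, ∑ w, if next σ m w = m' then v m * p w else 0 := by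
  simp [vecMul, dotProduct, transitionMatrix, mul_add]

theorem sum_vecMul_transitionMatrix (hp : ∑ w, p w = 1) (v : StateSpace σ → ℝ) :
    ∑ m, (v ᵥ* transitionMatrix σ p) m = ∑ m, v m := by
  simp only [vecMul_transitionMatrix]
  rw [Finset.sum_comm]
  refine Finset.sum_congr rfl fun m _ => ?_
  rw [Finset.sum_comm]
  simp [← Finset.mul_sum, hp]

/-- A harmonic function takes its maximum at the state reached after a win of player 1. -/
theorem le_reset_of_harmonic (hσ : Feasible σ) (hpos : ∀ i, 0 < p i) (hp : ∑ w, p w = 1)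
    (h : StateSpace σ → ℝ) (hh : transitionMatrix σ p *ᵥ h = h) (m : StateSpace σ) :
    h m ≤ h ⟨resetState σ 0, Reachable.reset 0⟩ := by
  obtain ⟨x, hx⟩ := Finite.exists_max h
  have key := reset_mem_of_closed hσ {y | h x ≤ h y} (fun y hy => ?_) ⟨x, le_refl (h x)⟩
  · exact (hx m).trans key
  -- The maximum set is closed: `h y` averages two values at most the maximum, and the weight `p 0`
  -- is positive.
  · have h1 := congrFun hh y
    rw [transitionMatrix_mulVec, Fin.sum_univ_two] at h1
    rw [Fin.sum_univ_two] at hp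
    have h2 := hx (next σ y 1)
    have h3 : h x ≤ h y := hy
    change h x ≤ h (next σ y 0)
    have h4 := mul_le_mul_of_nonneg_left h2 (hpos 1).le
    have h5 : p 0 * h x ≤ p 0 * h (next σ y 0) := by
      have : h x = p 0 * h x + p 1 * h x := by rw [← add_mul, hp, one_mul]
      linarith
    exact le_of_mul_le_mul_left h5 (hpos 0)

theorem harmonic_eq_const (hσ : Feasible σ) (hpos : ∀ i, 0 < p i) (hp : ∑ w, p w = 1)
    (h : StateSpace σ → ℝ) (hh : transitionMatrix σ p *ᵥ h = h) (m : StateSpace σ) :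
    h m = h ⟨resetState σ 0, Reachable.reset 0⟩ := by
  refine le_antisymm (le_reset_of_harmonic hσ hpos hp h hh m) ?_
  have := le_reset_of_harmonic hσ hpos hp (-h) (by rw [mulVec_neg, hh]) m
  simpa using this

/-- Constants are in the right kernel of `1 - P`, so there is a left null vector `v`. By the
triangle inequality `|v| ≤ |v| P`; both sides have the same total mass, so they agree, and `|v|` can
be normalised. -/
theorem exists_isStationary (hpos : ∀ i, 0 < p i) (hp : ∑ w, p w = 1) :
    ∃ π : StateSpace σ → ℝ, IsStationary σ p π := by
  classical
  have hdet : (1 - transitionMatrix σ p).det = 0 := by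
    rw [← exists_mulVec_eq_zero_iff]
    refine ⟨fun _ => 1, fun h => one_ne_zero (congrFun h (Classical.arbitrary _)), ?_⟩
    ext m
    rw [sub_mulVec, one_mulVec, Pi.sub_apply, transitionMatrix_mulVec]
    simp only [mul_one, hp, sub_self, Pi.zero_apply]
  obtain ⟨v, hv0, hv⟩ := exists_vecMul_eq_zero_iff.2 hdet
  rw [vecMul_sub, vecMul_one, sub_eq_zero] at hv
  set u : StateSpace σ → ℝ := fun m => |v m| with hu
  have hle : ∀ m, u m ≤ (u ᵥ* transitionMatrix σ p) m := by
    intro m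
    have : u m = |(v ᵥ* transitionMatrix σ p) m| := by rw [← hv]
    rw [this, vecMul_transitionMatrix, vecMul_transitionMatrix]
    refine (Finset.abs_sum_le_sum_abs _ _).trans (Finset.sum_le_sum fun x _ => ?_)
    refine (Finset.abs_sum_le_sum_abs _ _).trans (Finset.sum_le_sum fun w _ => ?_)
    split_ifs
    · rw [abs_mul, abs_of_pos (hpos w)]
    · simp
  have heq : u ᵥ* transitionMatrix σ p = u := by
    ext m
    exact ((Finset.sum_eq_sum_iff_of_le fun m _ => hle m).1
      (sum_vecMul_transitionMatrix hp u).symm m (Finset.mem_univ m)).symm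
  have hs : 0 < ∑ m, u m := by
    obtain ⟨m, hm⟩ := Function.ne_iff.1 hv0
    exact Finset.sum_pos' (fun _ _ => abs_nonneg _) ⟨m, Finset.mem_univ m, abs_pos.2 hm⟩
  refine ⟨(∑ m, u m)⁻¹ • u, ⟨fun m => ?_, ?_⟩, ?_⟩
  · exact mul_nonneg (inv_nonneg.2 hs.le) (abs_nonneg _)
  · simp only [Pi.smul_apply, smul_eq_mul, ← Finset.mul_sum]
    exact inv_mul_cancel₀ hs.ne'
  · rw [smul_vecMul, heq]

/-- The Poisson equation is solvable for every right-hand side of mean zero. -/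
theorem exists_poisson (hσ : Feasible σ) (hpos : ∀ i, 0 < p i) (hp : ∑ w, p w = 1)
    {π : StateSpace σ → ℝ} (hπ : IsStationary σ p π) (f : StateSpace σ → ℝ) :
    ∃ h : StateSpace σ → ℝ, ∀ m, h m - ∑ w, p w * h (next σ m w) = f m - π ⬝ᵥ f := by
  classical
  set T := (1 - transitionMatrix σ p).mulVecLin with hT
  have hTapp : ∀ h m, T h m = h m - ∑ w, p w * h (next σ m w) := fun h m => by
    rw [hT, mulVecLin_apply, sub_mulVec, one_mulVec, Pi.sub_apply, transitionMatrix_mulVec]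
  set φ : (StateSpace σ → ℝ) →ₗ[ℝ] ℝ := dotProductBilin ℝ ℝ π with hφ
  have hφapp : ∀ h, φ h = π ⬝ᵥ h := fun h => rfl
  have hone : ∀ c : ℝ, π ⬝ᵥ (fun _ => c) = c := fun c => by
    simp only [dotProduct, ← Finset.sum_mul, hπ.1.2, one_mul]
  have hle : LinearMap.range T ≤ LinearMap.ker φ := by
    rintro _ ⟨h, rfl⟩
    rw [LinearMap.mem_ker, hφapp, hT, mulVecLin_apply, dotProduct_mulVec, vecMul_sub, hπ.2,
      vecMul_one, sub_self, zero_dotProduct]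
  have hker : LinearMap.ker T ≤ Submodule.span ℝ {fun _ => (1 : ℝ)} := by
    intro h hh
    rw [LinearMap.mem_ker, hT, mulVecLin_apply, sub_mulVec, one_mulVec, sub_eq_zero] at hh
    refine Submodule.mem_span_singleton.2 ⟨h ⟨resetState σ 0, Reachable.reset 0⟩, ?_⟩
    ext m
    rw [harmonic_eq_const hσ hpos hp h hh.symm m]
    simp
  have h1 : Module.finrank ℝ (LinearMap.ker T) ≤ 1 :=
    (Submodule.finrank_mono hker).trans (finrank_span_singleton (fun h => one_ne_zero
      (congrFun h (Classical.arbitrary (StateSpace σ))))).le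
  have h2 := T.finrank_range_add_finrank_ker
  have h3 := φ.finrank_range_add_finrank_ker
  have h4 : LinearMap.range φ = ⊤ :=
    LinearMap.range_eq_top.2 fun c => ⟨fun _ => c, hone c⟩
  rw [h4, finrank_top, Module.finrank_self] at h3
  -- The kernel of `T` has dimension at most 1, so its range is at least as large as the hyperplane
  -- `ker φ` that contains it.
  have h5 : LinearMap.range T = LinearMap.ker φ :=
    Submodule.eq_of_le_of_finrank_le hle (by omega)
  have h6 : (f - fun _ => π ⬝ᵥ f) ∈ LinearMap.range T := by
    rw [h5, LinearMap.mem_ker, map_sub, hφapp, hφapp, hone, sub_self]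
  obtain ⟨h, hh⟩ := h6
  exact ⟨h, fun m => by rw [← hTapp, hh]; rfl⟩

theorem IsStationary.dotProduct_mulVec {π : StateSpace σ → ℝ} (hπ : IsStationary σ p π)
    (h : StateSpace σ → ℝ) :
    π ⬝ᵥ (fun m => ∑ w, p w * h (next σ m w)) = π ⬝ᵥ h := by
  have : (fun m => ∑ w, p w * h (next σ m w)) = transitionMatrix σ p *ᵥ h :=
    funext fun m => (transitionMatrix_mulVec h m).symm
  rw [this, Matrix.dotProduct_mulVec, hπ.2]

/-- Pairing the Poisson equation for `π` with `π'` annihilates its left side, leaving `⟨π', f⟩ = ⟨π,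
f⟩` for every `f`. -/
theorem IsStationary.eq (hσ : Feasible σ) (hpos : ∀ i, 0 < p i) (hp : ∑ w, p w = 1)
    {π π' : StateSpace σ → ℝ} (hπ : IsStationary σ p π) (hπ' : IsStationary σ p π') :
    π' = π := by
  classical
  refine dotProduct_eq _ _ fun f => ?_
  obtain ⟨h, hh⟩ := exists_poisson hσ hpos hp hπ f
  have h1 : (h - fun m => ∑ w, p w * h (next σ m w)) = f - fun _ => π ⬝ᵥ f := funext hh
  have h2 := congrArg (fun g => π' ⬝ᵥ g) h1
  simp only [dotProduct_sub, hπ'.dotProduct_mulVec, sub_self] at h2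
  have h3 : π' ⬝ᵥ (fun _ => π ⬝ᵥ f) = π ⬝ᵥ f := by
    rw [dotProduct, ← Finset.sum_mul, hπ'.1.2, one_mul]
  linarith

/-! ### Positivity of the validation rate -/

/-- The support of `π` is closed, hence contains a boundary state, where at least one block is
validated when player 1 wins. -/
theorem IsStationary.next_pos (hpos : ∀ i, 0 < p i) {π : StateSpace σ → ℝ}
    (hπ : IsStationary σ p π) {m : StateSpace σ} (hm : 0 < π m) (w : Fin 2) :
    0 < π (next σ m w) := by
  rw [← hπ.2, vecMul_transitionMatrix]
  have hnn : ∀ x v, 0 ≤ if next σ x v = next σ m w then π x * p v else 0 := fun x v => by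
    split_ifs
    · exact mul_nonneg (hπ.1.1 x) (hpos v).le
    · exact le_rfl
  refine Finset.sum_pos' (fun x _ => Finset.sum_nonneg fun v _ => hnn x v)
    ⟨m, Finset.mem_univ m, Finset.sum_pos' (fun v _ => hnn m v) ⟨w, Finset.mem_univ w, ?_⟩⟩
  rw [if_pos rfl]
  exact mul_pos hm (hpos w)

theorem one_le_of_mem_boundary (hσ : Feasible σ) (i : Fin 2) {m : StateSpace σ}
    (hm : m ∈ boundary σ i) :
    1 ≤ ((branch i m.1 : ℕ) : ℝ) + 1 - (((σ (opp i)).s : ℕ) : ℝ) := by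
  have h : (((σ (opp i)).s : ℕ) : ℝ) ≤ ((branch i m.1 : ℕ) : ℝ) :=
    Nat.cast_le.2 ((hσ m.1 m.2 i).2 hm)
  linarith

theorem reward_nonneg (hσ : Feasible σ) (i : Fin 2) (m : StateSpace σ) (w : Fin 2) :
    0 ≤ reward σ i m w := by
  unfold reward
  split_ifs with h
  · linarith [one_le_of_mem_boundary hσ i h.2]
  · exact le_rfl

theorem sum_mul_reward (i : Fin 2) (m : StateSpace σ) :
    ∑ w, p w * reward σ i m w = rhat σ p i m := by
  classical
  unfold reward rhat
  by_cases h : m ∈ boundary σ i <;> simp [h]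

theorem rhat_nonneg (hσ : Feasible σ) (hpos : ∀ i, 0 < p i) (i : Fin 2) (m : StateSpace σ) :
    0 ≤ rhat σ p i m := by
  rw [← sum_mul_reward]
  exact Finset.sum_nonneg fun w _ => mul_nonneg (hpos w).le (reward_nonneg hσ i m w)

theorem dotProduct_rhat_pos (hσ : Feasible σ) (hpos : ∀ i, 0 < p i) {π : StateSpace σ → ℝ}
    (hπ : IsStationary σ p π) : 0 < π ⬝ᵥ (rhat σ p 0 + rhat σ p 1) := by
  classical
  have hne : ({m | 0 < π m} : Set (StateSpace σ)).Nonempty := by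
    by_contra hcon
    have : ∀ m, π m = 0 := fun m => le_antisymm (not_lt.1 fun h => hcon ⟨m, h⟩) (hπ.1.1 m)
    have h1 := hπ.1.2
    simp [this] at h1
  obtain ⟨m, hm, hb⟩ := exists_mem_boundary_of_closed hσ {m | 0 < π m}
    (fun m hm => hπ.next_pos hpos hm 0) hne
  refine Finset.sum_pos' (fun x _ => mul_nonneg (hπ.1.1 x)
    (add_nonneg (rhat_nonneg hσ hpos 0 x) (rhat_nonneg hσ hpos 1 x))) ⟨m, Finset.mem_univ m, ?_⟩
  refine mul_pos hm (add_pos_of_pos_of_nonneg ?_ (rhat_nonneg hσ hpos 1 m))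
  rw [rhat, if_pos hb]
  exact mul_pos (hpos 0) (lt_of_lt_of_le one_pos (one_le_of_mem_boundary hσ 0 hb))

/-! ### The law of the races and independence -/

/-- The law of the winner of a race. -/
noncomputable def winnerLaw (p : Fin 2 → ℝ) : Measure (Fin 2) :=
  ∑ i : Fin 2, ENNReal.ofReal (p i) • Measure.dirac i

theorem isProbabilityMeasure_winnerLaw (hpos : ∀ i, 0 < p i) (hp : ∑ w, p w = 1) :
    IsProbabilityMeasure (winnerLaw p) := by
  constructor
  simp only [winnerLaw, Measure.coe_finsetSum, Finset.sum_apply, Measure.smul_apply, measure_univ,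
    smul_eq_mul, mul_one]
  rw [← ENNReal.ofReal_sum_of_nonneg fun i _ => (hpos i).le, hp, ENNReal.ofReal_one]

theorem winnerLaw_real_singleton (hpos : ∀ i, 0 < p i) (w : Fin 2) :
    (winnerLaw p).real {w} = p w := by
  have : winnerLaw p {w} = ENNReal.ofReal (p w) := by
    simp [winnerLaw, Set.indicator_apply]
    fin_cases w <;> simp
  rw [Measure.real, this, ENNReal.toReal_ofReal (hpos w).le]

theorem raceLaw_eq : raceLaw p lam =
    Measure.infinitePi fun _ : ℕ => (winnerLaw p).prod (expMeasure lam) := rfl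

theorem isProbabilityMeasure_raceLaw (hpos : ∀ i, 0 < p i) (hp : ∑ w, p w = 1) (hlam : 0 < lam) :
    IsProbabilityMeasure (raceLaw p lam) := by
  have := isProbabilityMeasure_winnerLaw hpos hp
  have := isProbabilityMeasure_expMeasure hlam
  rw [raceLaw_eq]
  infer_instance

/-- `F` is determined by the winners of the races in `S`. -/
def DependsOnWinners {β : Type*} (S : Finset ℕ) (F : Races → β) : Prop :=
  ∀ ω ω' : Races, (∀ j ∈ S, (ω j).1 = (ω' j).1) → F ω = F ω'

/-- Finitely many winners take finitely many values, so measurability, boundedness and integrability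
come for free. -/
theorem DependsOnWinners.factor {β : Type*} {S : Finset ℕ} {F : Races → β}
    (hF : DependsOnWinners S F) :
    ∃ φ : (S → Fin 2) → β, ∀ ω, F ω = φ (fun j => (ω j).1) := by
  classical
  refine ⟨fun h => F fun j => (if hj : j ∈ S then h ⟨j, hj⟩ else 0, 0), fun ω => hF _ _ ?_⟩
  intro j hj
  simp [hj]

theorem measurable_winners (S : Finset ℕ) :
    Measurable fun (ω : Races) (j : S) => (ω j).1 := by
  fun_prop

theorem DependsOnWinners.measurable {S : Finset ℕ} {F : Races → ℝ}
    (hF : DependsOnWinners S F) : Measurable F := by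
  obtain ⟨φ, hφ⟩ := hF.factor
  rw [funext hφ]
  exact (measurable_of_finite φ).comp (measurable_winners S)

theorem DependsOnWinners.exists_bound {S : Finset ℕ} {F : Races → ℝ}
    (hF : DependsOnWinners S F) : ∃ c, ∀ ω, ‖F ω‖ ≤ c := by
  obtain ⟨φ, hφ⟩ := hF.factor
  obtain ⟨x, hx⟩ := Finite.exists_max fun h => ‖φ h‖
  exact ⟨‖φ x‖, fun ω => by rw [hφ]; exact hx _⟩

theorem DependsOnWinners.integrable [IsProbabilityMeasure (raceLaw p lam)] {S : Finset ℕ}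
    {F : Races → ℝ} (hF : DependsOnWinners S F) : Integrable F (raceLaw p lam) := by
  obtain ⟨c, hc⟩ := hF.exists_bound
  exact Integrable.of_bound hF.measurable.aestronglyMeasurable c (ae_of_all _ hc)

theorem measurePreserving_race (hpos : ∀ i, 0 < p i) (hp : ∑ w, p w = 1) (hlam : 0 < lam)
    (k : ℕ) : MeasurePreserving (fun ω : Races => ω k) (raceLaw p lam)
      ((winnerLaw p).prod (expMeasure lam)) := by
  have := isProbabilityMeasure_winnerLaw hpos hp
  have := isProbabilityMeasure_expMeasure hlam
  rw [raceLaw_eq]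
  exact measurePreserving_eval_infinitePi
    (fun _ : ℕ => (winnerLaw p).prod (expMeasure lam)) k

theorem indepFun_winners_race (hpos : ∀ i, 0 < p i) (hp : ∑ w, p w = 1) (hlam : 0 < lam)
    {S : Finset ℕ} {k : ℕ} (hk : k ∉ S) :
    IndepFun (fun (ω : Races) (j : S) => (ω j).1) (fun ω : Races => ω k) (raceLaw p lam) := by
  have := isProbabilityMeasure_winnerLaw hpos hp
  have := isProbabilityMeasure_expMeasure hlam
  have h : iIndepFun (fun (i : ℕ) (ω : Races) => ω i) (raceLaw p lam) := by
    rw [raceLaw_eq]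
    exact iIndepFun_infinitePi (P := fun _ : ℕ => (winnerLaw p).prod (expMeasure lam))
      (X := fun _ x => x) (fun _ => measurable_id)
  have h2 := h.indepFun_finset S {k} (Finset.disjoint_singleton_right.2 hk)
    (fun i => measurable_pi_apply i)
  exact h2.comp (φ := fun (x : S → Fin 2 × ℝ) (j : S) => (x j).1)
    (ψ := fun x : ({k} : Finset ℕ) → Fin 2 × ℝ => x ⟨k, Finset.mem_singleton_self k⟩)
    (by fun_prop) (by fun_prop)

/-- The length of a race is independent of all winners, and its winner is independent of the
winners of the other races. -/
theorem integral_mul_length (hpos : ∀ i, 0 < p i) (hp : ∑ w, p w = 1) (hlam : 0 < lam)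
    {S : Finset ℕ} {k : ℕ} (hk : k ∉ S) (F : Fin 2 → Races → ℝ)
    (hF : ∀ w, DependsOnWinners S (F w)) {g : ℝ → ℝ} (hg : Integrable g (expMeasure lam))
    (hgm : Measurable g) :
    Integrable (fun ω => F (ω k).1 ω * g (ω k).2) (raceLaw p lam) ∧
    ∫ ω, F (ω k).1 ω * g (ω k).2 ∂(raceLaw p lam) =
      (∫ ω, ∑ w, p w * F w ω ∂(raceLaw p lam)) * ∫ t, g t ∂(expMeasure lam) := by
  classical
  have := isProbabilityMeasure_winnerLaw hpos hp
  have := isProbabilityMeasure_expMeasure hlam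
  have := isProbabilityMeasure_raceLaw hpos hp hlam
  -- Splitting according to the winner of race `k` turns the integrand into a finite sum of products
  -- of independent factors.
  let u : Fin 2 → Fin 2 × ℝ → ℝ := fun w x => ({w} : Set (Fin 2)).indicator 1 x.1 * g x.2
  have hind : ∀ w, Measurable (({w} : Set (Fin 2)).indicator (1 : Fin 2 → ℝ)) := fun w =>
    measurable_of_finite _
  have hum : ∀ w, Measurable (u w) := fun w =>
    ((hind w).comp measurable_fst).mul (hgm.comp measurable_snd)
  have hui : ∀ w, Integrable (u w) ((winnerLaw p).prod (expMeasure lam)) := fun w =>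
    Integrable.mul_prod (Integrable.of_finite (f := ({w} : Set (Fin 2)).indicator 1)) hg
  have huI : ∀ w, ∫ ω, u w (ω k) ∂(raceLaw p lam) = p w * ∫ t, g t ∂(expMeasure lam) := by
    intro w
    have h1 := (measurePreserving_race hpos hp hlam k).map_eq
    have h2 : ∫ ω, u w (ω k) ∂(raceLaw p lam) =
        ∫ x, u w x ∂((winnerLaw p).prod (expMeasure lam)) := by
      rw [← h1, integral_map (measurable_pi_apply k).aemeasurable
        (hum w).aestronglyMeasurable]
    rw [h2, integral_prod_mul (({w} : Set (Fin 2)).indicator (1 : Fin 2 → ℝ)) g,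
      integral_indicator_one (measurableSet_singleton w), winnerLaw_real_singleton hpos]
  have hind2 : ∀ w, IndepFun (F w) (fun ω => u w (ω k)) (raceLaw p lam) := by
    intro w
    obtain ⟨φ, hφ⟩ := (hF w).factor
    rw [funext hφ]
    exact (indepFun_winners_race hpos hp hlam hk).comp (measurable_of_finite φ) (hum w)
  have hint : ∀ w, Integrable (fun ω => u w (ω k)) (raceLaw p lam) := fun w =>
    (measurePreserving_race hpos hp hlam k).integrable_comp_of_integrable (hui w)
  have hprod : ∀ w, Integrable (fun ω => F w ω * u w (ω k)) (raceLaw p lam) := fun w =>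
    (hind2 w).integrable_mul (hF w).integrable (hint w)
  have hsum : (fun ω : Races => F (ω k).1 ω * g (ω k).2) =
      fun ω => ∑ w, F w ω * u w (ω k) := by
    ext ω
    simp [u, Set.indicator_apply]
  rw [hsum]
  refine ⟨integrable_finsetSum _ fun w _ => hprod w, ?_⟩
  rw [integral_finsetSum _ fun w _ => hprod w,
    integral_finsetSum _ fun w _ => (hF w).integrable.const_mul _, Finset.sum_mul]
  refine Finset.sum_congr rfl fun w _ => ?_
  rw [(hind2 w).integral_fun_mul_eq_mul_integral (hF w).measurable.aestronglyMeasurable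
    (hint w).aestronglyMeasurable, huI, integral_const_mul]
  ring

/-- This serves as conditioning on the past: the winner of race `k` is averaged out while the races
in `S` stay. -/
theorem integral_winner (hpos : ∀ i, 0 < p i) (hp : ∑ w, p w = 1) (hlam : 0 < lam)
    {S : Finset ℕ} {k : ℕ} (hk : k ∉ S) (F : Fin 2 → Races → ℝ)
    (hF : ∀ w, DependsOnWinners S (F w)) :
    ∫ ω, F (ω k).1 ω ∂(raceLaw p lam) = ∫ ω, ∑ w, p w * F w ω ∂(raceLaw p lam) := by
  have := isProbabilityMeasure_expMeasure hlam
  have := (integral_mul_length hpos hp hlam hk F hF (integrable_const (1 : ℝ))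
    measurable_const).2
  simpa using this

theorem integrable_id_expMeasure (hlam : 0 < lam) :
    Integrable (fun t : ℝ => t) (expMeasure lam) := by
  have hm : Measurable (exponentialPDF lam) :=
    (measurable_exponentialPDFReal lam).ennreal_ofReal
  change Integrable (fun t : ℝ => t) (volume.withDensity (exponentialPDF lam))
  rw [integrable_withDensity_iff_integrable_smul' hm (ae_of_all _ fun x => ENNReal.ofReal_lt_top)]
  have h1 : IntegrableOn (fun x : ℝ => lam * (x ^ (1 : ℝ) * Real.exp (-lam * x ^ (1 : ℝ))))
      (Set.Ioi 0) :=
    (integrableOn_rpow_mul_exp_neg_mul_rpow (by norm_num) (by norm_num) hlam).const_mul lam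
  rw [← integrable_indicator_iff measurableSet_Ioi] at h1
  refine h1.congr (ae_of_all _ fun x => ?_)
  simp only [Set.indicator_apply, Set.mem_Ioi, Real.rpow_one, exponentialPDF_eq, smul_eq_mul]
  rcases lt_trichotomy x 0 with h | h | h
  · simp [not_lt.2 h.le, not_le.2 h]
  · simp [h]
  · rw [if_pos h, if_pos h.le, ENNReal.toReal_ofReal (by positivity), neg_mul]
    ring

/-! ### Path sums and martingale estimates -/

/-- The sum of `g` along the first `n` transitions of the chain started at `m`. -/
noncomputable def pathSum (σ : Fin 2 → CapitulationPolicy d) (g : StateSpace σ → Fin 2 → ℝ)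
    (m : StateSpace σ) (n : ℕ) (ω : Races) : ℝ :=
  ∑ k ∈ Finset.range n, g (X σ k (m, ω)) (ω k).1

theorem dependsOnWinners_X (m : StateSpace σ) (n : ℕ) :
    DependsOnWinners (Finset.range n) fun ω => X σ n (m, ω) := by
  induction n with
  | zero => exact fun _ _ _ => rfl
  | succ n ih =>
    intro ω ω' h
    simp only [X]
    have h1 : X σ n (m, ω) = X σ n (m, ω') :=
      ih ω ω' fun j hj => h j (Finset.range_subset_range.2 n.le_succ hj)
    rw [h n (Finset.self_mem_range_succ n), h1]

theorem dependsOnWinners_pathSum (g : StateSpace σ → Fin 2 → ℝ) (m : StateSpace σ) (n : ℕ) :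
    DependsOnWinners (Finset.range n) (pathSum σ g m n) := by
  intro ω ω' h
  refine Finset.sum_congr rfl fun k hk => ?_
  have h1 : X σ k (m, ω) = X σ k (m, ω') := dependsOnWinners_X m k ω ω' fun j hj =>
    h j (Finset.range_subset_range.2 (Finset.mem_range.1 hk).le hj)
  rw [h k hk, h1]

theorem DependsOnWinners.comp {β γ : Type*} {S : Finset ℕ} {F : Races → β}
    (hF : DependsOnWinners S F) (φ : β → γ) : DependsOnWinners S fun ω => φ (F ω) :=
  fun ω ω' h => congrArg φ (hF ω ω' h)

theorem DependsOnWinners.comp₂ {α β γ : Type*} {S : Finset ℕ} {F : Races → α} {G : Races → β}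
    (hF : DependsOnWinners S F) (hG : DependsOnWinners S G) (φ : α → β → γ) :
    DependsOnWinners S fun ω => φ (F ω) (G ω) :=
  fun ω ω' h => congrArg₂ φ (hF ω ω' h) (hG ω ω' h)

theorem pathSum_succ (g : StateSpace σ → Fin 2 → ℝ) (m : StateSpace σ) (n : ℕ) (ω : Races) :
    pathSum σ g m (n + 1) ω = pathSum σ g m n ω + g (X σ n (m, ω)) (ω n).1 :=
  Finset.sum_range_succ _ _

/-- A function of a transition is a constant plus a martingale difference plus a coboundary. -/
theorem exists_martingale_decomposition (hσ : Feasible σ) (hpos : ∀ i, 0 < p i)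
    (hp : ∑ w, p w = 1) {π : StateSpace σ → ℝ} (hπ : IsStationary σ p π)
    (g : StateSpace σ → Fin 2 → ℝ) {f : StateSpace σ → ℝ} (hf : ∀ m, ∑ w, p w * g m w = f m) :
    ∃ (D : StateSpace σ → Fin 2 → ℝ) (h : StateSpace σ → ℝ), (∀ m, ∑ w, p w * D m w = 0) ∧
      ∀ m n ω, pathSum σ g m n ω = n * (π ⬝ᵥ f) + pathSum σ D m n ω + h m
        - h (X σ n (m, ω)) := by
  obtain ⟨h, hh⟩ := exists_poisson hσ hpos hp hπ f
  -- The Poisson equation says exactly that this increment has mean zero at each state; the terms in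
  -- `h` telescope along the path.
  refine ⟨fun m w => g m w - π ⬝ᵥ f + h (next σ m w) - h m, h, fun m => ?_, fun m n ω => ?_⟩
  · have h1 := hh m
    rw [← hf m] at h1
    rw [Fin.sum_univ_two] at *
    rw [Fin.sum_univ_two] at h1
    linear_combination (- (1 : ℝ)) * h1 - (π ⬝ᵥ f + h m) * hp
  · induction n with
    | zero => simp [pathSum, X]
    | succ n ih =>
      rw [pathSum_succ, pathSum_succ, ih]
      simp only [X, Nat.cast_add, Nat.cast_one]
      ring

theorem exists_abs_le_pos {ι : Type*} [Finite ι] (f : ι → ℝ) : ∃ K, 0 < K ∧ ∀ i, |f i| ≤ K := by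
  obtain ⟨K, hK⟩ := (Set.finite_range fun i => |f i|).bddAbove
  exact ⟨max K 1, by positivity, fun i => (hK ⟨i, rfl⟩).trans (le_max_left _ _)⟩

/-- Given the past, the cross term with a new increment has mean zero, so each turn adds at most `K
^ 2`. -/
theorem integral_pathSum_sq_le
    (hpos : ∀ i, 0 < p i) (hp : ∑ w, p w = 1) (hlam : 0 < lam)
    {D : StateSpace σ → Fin 2 → ℝ} (hD : ∀ m, ∑ w, p w * D m w = 0) {K : ℝ}
    (hK : ∀ m w, |D m w| ≤ K) (m : StateSpace σ) (n : ℕ) :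
    ∫ ω, (pathSum σ D m n ω) ^ 2 ∂(raceLaw p lam) ≤ n * K ^ 2 := by
  have := isProbabilityMeasure_raceLaw hpos hp hlam
  induction n with
  | zero => simp [pathSum]
  | succ n ih =>
    have hM := dependsOnWinners_pathSum D m n
    have hX := dependsOnWinners_X m n
    simp only [pathSum_succ]
    rw [integral_winner hpos hp hlam (Finset.notMem_range_self (n := n))
      (fun w ω => (pathSum σ D m n ω + D (X σ n (m, ω)) w) ^ 2)
      fun w => hM.comp₂ hX fun a b => (a + D b w) ^ 2]
    have h1 : ∀ ω, ∑ w, p w * (pathSum σ D m n ω + D (X σ n (m, ω)) w) ^ 2 ≤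
        (pathSum σ D m n ω) ^ 2 + K ^ 2 := by
      intro ω
      have h2 := hD (X σ n (m, ω))
      have h3 := mul_le_mul_of_nonneg_left
        (sq_le_sq' (abs_le.1 (hK (X σ n (m, ω)) 0)).1 (abs_le.1 (hK (X σ n (m, ω)) 0)).2)
        (hpos 0).le
      have h4 := mul_le_mul_of_nonneg_left
        (sq_le_sq' (abs_le.1 (hK (X σ n (m, ω)) 1)).1 (abs_le.1 (hK (X σ n (m, ω)) 1)).2)
        (hpos 1).le
      have h5 := hp
      rw [Fin.sum_univ_two] at h2 h5 ⊢
      generalize pathSum σ D m n ω = a at *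
      have e : p 0 * (a + D (X σ n (m, ω)) 0) ^ 2 + p 1 * (a + D (X σ n (m, ω)) 1) ^ 2 =
          a ^ 2 + p 0 * D (X σ n (m, ω)) 0 ^ 2 + p 1 * D (X σ n (m, ω)) 1 ^ 2 := by
        linear_combination 2 * a * h2 + a ^ 2 * h5
      have e2 : p 0 * K ^ 2 + p 1 * K ^ 2 = K ^ 2 := by rw [← add_mul, h5, one_mul]
      linarith
    have hint := (hM.comp fun a => a ^ 2).integrable (p := p) (lam := lam)
    calc _ ≤ ∫ ω, ((pathSum σ D m n ω) ^ 2 + K ^ 2) ∂(raceLaw p lam) := by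
          refine integral_mono (DependsOnWinners.integrable (S := Finset.range n) ?_)
            (hint.add (integrable_const _)) h1
          exact hM.comp₂ hX fun a b => ∑ w, p w * (a + D b w) ^ 2
      _ ≤ _ := by
          rw [integral_add hint (integrable_const _), integral_const]
          simp only [probReal_univ, one_smul]
          push_cast
          linarith

/-- For `|x| ≤ 1`, `exp x ≤ 1 + x + x ^ 2`. The linear term averages to zero, so each turn costs a
factor at most `exp ((θ * K) ^ 2)`. -/
theorem integral_exp_pathSum_le
    (hpos : ∀ i, 0 < p i) (hp : ∑ w, p w = 1) (hlam : 0 < lam)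
    {D : StateSpace σ → Fin 2 → ℝ} (hD : ∀ m, ∑ w, p w * D m w = 0) {K : ℝ}
    (hK : ∀ m w, |D m w| ≤ K) {θ : ℝ} (hθ : 0 ≤ θ) (hθK : θ * K ≤ 1) (m : StateSpace σ)
    (n : ℕ) :
    ∫ ω, Real.exp (-θ * pathSum σ D m n ω) ∂(raceLaw p lam) ≤ Real.exp (n * (θ * K) ^ 2) := by
  have := isProbabilityMeasure_raceLaw hpos hp hlam
  induction n with
  | zero => simp [pathSum]
  | succ n ih =>
    have hM := dependsOnWinners_pathSum D m n
    have hX := dependsOnWinners_X m n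
    simp only [pathSum_succ]
    rw [integral_winner hpos hp hlam (Finset.notMem_range_self (n := n))
      (fun w ω => Real.exp (-θ * (pathSum σ D m n ω + D (X σ n (m, ω)) w)))
      fun w => hM.comp₂ hX fun a b => Real.exp (-θ * (a + D b w))]
    have hstep : ∀ x w, Real.exp (-θ * D x w) ≤ 1 + (θ * K) ^ 2 - θ * D x w := by
      intro x w
      have h0 : |-θ * D x w| ≤ θ * K := by
        rw [abs_mul, abs_neg, abs_of_nonneg hθ]
        exact mul_le_mul_of_nonneg_left (hK x w) hθ
      have h1 := (abs_le.1 (Real.abs_exp_sub_one_sub_id_le (h0.trans hθK))).2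
      have h2 := sq_le_sq' (abs_le.1 h0).1 (abs_le.1 h0).2
      linarith
    have h1 : ∀ ω, ∑ w, p w * Real.exp (-θ * (pathSum σ D m n ω + D (X σ n (m, ω)) w)) ≤
        Real.exp (-θ * pathSum σ D m n ω) * Real.exp ((θ * K) ^ 2) := by
      intro ω
      have h2 := hD (X σ n (m, ω))
      have h3 : ∑ w, p w * Real.exp (-θ * (pathSum σ D m n ω + D (X σ n (m, ω)) w)) =
          Real.exp (-θ * pathSum σ D m n ω) *
            ∑ w, p w * Real.exp (-θ * D (X σ n (m, ω)) w) := by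
        rw [Finset.mul_sum]
        refine Finset.sum_congr rfl fun w _ => ?_
        rw [mul_add, Real.exp_add]
        ring
      rw [h3]
      refine mul_le_mul_of_nonneg_left ?_ (Real.exp_pos _).le
      calc _ ≤ ∑ w, p w * (1 + (θ * K) ^ 2 - θ * D (X σ n (m, ω)) w) :=
            Finset.sum_le_sum fun w _ => mul_le_mul_of_nonneg_left (hstep _ w) (hpos w).le
        _ = (θ * K) ^ 2 + 1 := by
            have h5 := hp
            rw [Fin.sum_univ_two] at h2 h5 ⊢
            linear_combination (1 + (θ * K) ^ 2) * h5 - θ * h2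
        _ ≤ _ := Real.add_one_le_exp _
    have hint := (hM.comp fun a => Real.exp (-θ * a)).integrable (p := p) (lam := lam)
    calc _ ≤ ∫ ω, Real.exp (-θ * pathSum σ D m n ω) * Real.exp ((θ * K) ^ 2)
            ∂(raceLaw p lam) := by
          refine integral_mono (DependsOnWinners.integrable (S := Finset.range n) ?_)
            (hint.mul_const _) h1
          exact hM.comp₂ hX fun a b => ∑ w, p w * Real.exp (-θ * (a + D b w))
      _ ≤ _ := by
          rw [integral_mul_const]
          refine (mul_le_mul_of_nonneg_right ih (Real.exp_pos _).le).trans_eq ?_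
          rw [← Real.exp_add]
          push_cast
          ring_nf

/-- The law of large numbers in `L¹`, with a rate. -/
theorem exists_integral_abs_pathSum_sub_le
    (hσ : Feasible σ) (hpos : ∀ i, 0 < p i) (hp : ∑ w, p w = 1) (hlam : 0 < lam)
    {π : StateSpace σ → ℝ} (hπ : IsStationary σ p π) (g : StateSpace σ → Fin 2 → ℝ)
    {f : StateSpace σ → ℝ} (hf : ∀ m, ∑ w, p w * g m w = f m) (m : StateSpace σ) :
    ∃ C, ∀ n : ℕ, 1 ≤ n →
      ∫ ω, |pathSum σ g m n ω - n * (π ⬝ᵥ f)| ∂(raceLaw p lam) ≤ C * √n := by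
  have := isProbabilityMeasure_raceLaw hpos hp hlam
  obtain ⟨D, h, hD, hdec⟩ := exists_martingale_decomposition hσ hpos hp hπ g hf
  obtain ⟨K, -, hK⟩ := exists_abs_le_pos fun x : StateSpace σ × Fin 2 => D x.1 x.2
  obtain ⟨H, hH0, hH⟩ := exists_abs_le_pos h
  -- `K ^ 2` is the variance share, `1` comes from `|M| ≤ M ^ 2 / √n + √n`, and `2 * H` bounds the
  -- two values of `h`.
  refine ⟨K ^ 2 + 1 + 2 * H, fun n hn => ?_⟩
  have hn1 : (1 : ℝ) ≤ √n := Real.one_le_sqrt.2 (by exact_mod_cast hn)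
  have hn0 : 0 < √(n : ℝ) := by linarith
  have hsq : √(n : ℝ) ^ 2 = n := Real.sq_sqrt (Nat.cast_nonneg n)
  have h1 : ∀ ω, |pathSum σ g m n ω - n * (π ⬝ᵥ f)| ≤
      (pathSum σ D m n ω) ^ 2 / √n + (√n + 2 * H) := by
    intro ω
    rw [hdec m n ω]
    have a1 := abs_le.1 (hH m)
    have a2 := abs_le.1 (hH (X σ n (m, ω)))
    generalize pathSum σ D m n ω = M
    have a3 : |M| ≤ M ^ 2 / √n + √n := by
      rw [← sub_le_iff_le_add, le_div_iff₀ hn0, ← sq_abs M]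
      nlinarith [sq_nonneg (|M| - √n), abs_nonneg M]
    have a4 := abs_le.1 a3
    rw [abs_le]
    constructor <;> linarith
  have hM := dependsOnWinners_pathSum D m n
  have hint := (hM.comp fun a => a ^ 2 / √n).integrable (p := p) (lam := lam)
  refine (integral_mono (DependsOnWinners.integrable (S := Finset.range n)
    ((dependsOnWinners_pathSum g m n).comp fun a => |a - n * (π ⬝ᵥ f)|))
    (hint.add (integrable_const _)) h1).trans ?_
  rw [integral_add' hint (integrable_const _), integral_const, integral_div]
  simp only [probReal_univ, one_smul]
  have h2 := integral_pathSum_sq_le hpos hp hlam hD (fun m w => hK (m, w)) m n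
  have h3 : (∫ ω, (pathSum σ D m n ω) ^ 2 ∂(raceLaw p lam)) / √n ≤ K ^ 2 * √n := by
    rw [div_le_iff₀ hn0]
    calc _ ≤ _ := h2
      _ = _ := by rw [mul_assoc, ← sq, hsq, mul_comm]
  nlinarith

/-- Sums of positive drift are exponentially unlikely to be small. -/
theorem exists_integral_exp_neg_pathSum_le
    (hσ : Feasible σ) (hpos : ∀ i, 0 < p i) (hp : ∑ w, p w = 1) (hlam : 0 < lam)
    {π : StateSpace σ → ℝ} (hπ : IsStationary σ p π) (g : StateSpace σ → Fin 2 → ℝ)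
    {f : StateSpace σ → ℝ} (hf : ∀ m, ∑ w, p w * g m w = f m) (hpf : 0 < π ⬝ᵥ f) (m : StateSpace σ) :
    ∃ θ C, 0 < θ ∧ ∀ n : ℕ, ∫ ω, Real.exp (-θ * pathSum σ g m n ω) ∂(raceLaw p lam) ≤
      C * Real.exp (-(θ * (π ⬝ᵥ f) / 2 * n)) := by
  have := isProbabilityMeasure_raceLaw hpos hp hlam
  obtain ⟨D, h, hD, hdec⟩ := exists_martingale_decomposition hσ hpos hp hπ g hf
  obtain ⟨K, hK0, hK⟩ := exists_abs_le_pos fun x : StateSpace σ × Fin 2 => D x.1 x.2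
  obtain ⟨H, hH0, hH⟩ := exists_abs_le_pos h
  set γ := π ⬝ᵥ f with hγ
  -- The first bound permits the exponential estimate; the second makes its cost `(θ * K) ^ 2` at
  -- most half of the drift `θ * γ`.
  set θ := min (1 / K) (γ / (2 * K ^ 2)) with hθ
  have hθ0 : 0 < θ := lt_min (by positivity) (by positivity)
  have hθ1 : θ * K ≤ 1 := by
    rw [← le_div_iff₀ hK0]
    exact min_le_left _ _
  have hθ2 : θ * (2 * K ^ 2) ≤ γ := by
    rw [← le_div_iff₀ (by positivity)]
    exact min_le_right _ _
  refine ⟨θ, Real.exp (2 * θ * H), hθ0, fun n => ?_⟩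
  have h1 : ∀ ω, Real.exp (-θ * pathSum σ g m n ω) ≤
      Real.exp (2 * θ * H - θ * γ * n) * Real.exp (-θ * pathSum σ D m n ω) := by
    intro ω
    rw [← Real.exp_add, Real.exp_le_exp, hdec m n ω]
    have a1 := mul_le_mul_of_nonneg_left (abs_le.1 (hH m)).1 hθ0.le
    have a2 := mul_le_mul_of_nonneg_left (abs_le.1 (hH (X σ n (m, ω)))).2 hθ0.le
    linarith
  have hint := ((dependsOnWinners_pathSum D m n).comp
    fun a => Real.exp (-θ * a)).integrable (p := p) (lam := lam)
  refine (integral_mono ((dependsOnWinners_pathSum g m n).comp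
    fun a => Real.exp (-θ * a)).integrable (hint.const_mul _) h1).trans ?_
  rw [integral_const_mul]
  refine (mul_le_mul_of_nonneg_left (integral_exp_pathSum_le hpos hp hlam hD
    (fun m w => hK (m, w)) hθ0.le hθ1 m n) (Real.exp_pos _).le).trans ?_
  rw [← Real.exp_add, ← Real.exp_add, Real.exp_le_exp]
  have h3 := mul_le_mul_of_nonneg_left hθ2 (mul_nonneg (Nat.cast_nonneg (α := ℝ) n) hθ0.le)
  nlinarith

/-! ### Limits of ratios from a fixed initial state -/

/-- The number of validated blocks of a transition. -/
noncomputable def totalReward (σ : Fin 2 → CapitulationPolicy d) (m : StateSpace σ) (w : Fin 2) :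
    ℝ := ∑ i, reward σ i m w

theorem sum_mul_totalReward (m : StateSpace σ) :
    ∑ w, p w * totalReward σ m w = (rhat σ p 0 + rhat σ p 1) m := by
  rw [Pi.add_apply, ← sum_mul_reward, ← sum_mul_reward, ← Finset.sum_add_distrib]
  refine Finset.sum_congr rfl fun w _ => ?_
  rw [totalReward, Fin.sum_univ_two, mul_add]

theorem pathSum_reward_nonneg (hσ : Feasible σ) (i : Fin 2) (m : StateSpace σ) (n : ℕ)
    (ω : Races) : 0 ≤ pathSum σ (reward σ i) m n ω :=
  Finset.sum_nonneg fun _ _ => reward_nonneg hσ i _ _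

theorem pathSum_reward_le (hσ : Feasible σ) (i : Fin 2) (m : StateSpace σ) (n : ℕ)
    (ω : Races) : pathSum σ (reward σ i) m n ω ≤ pathSum σ (totalReward σ) m n ω :=
  Finset.sum_le_sum fun _ _ => Finset.single_le_sum
    (f := fun i => reward σ i _ _) (fun j _ => reward_nonneg hσ j _ _) (Finset.mem_univ i)

theorem pathSum_totalReward_nonneg (hσ : Feasible σ) (m : StateSpace σ) (n : ℕ)
    (ω : Races) : 0 ≤ pathSum σ (totalReward σ) m n ω :=
  (pathSum_reward_nonneg hσ 0 m n ω).trans (pathSum_reward_le hσ 0 m n ω)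

theorem tendsto_const_mul_inv_sqrt (C : ℝ) :
    Tendsto (fun n : ℕ => C * (√(n : ℝ))⁻¹) atTop (𝓝 0) := by
  have h : Tendsto (fun n : ℕ => √(n : ℝ)) atTop atTop :=
    Real.tendsto_sqrt_atTop.comp tendsto_natCast_atTop_atTop
  simpa using (tendsto_inv_atTop_zero.comp h).const_mul C

theorem tendsto_integral_of_abs_sub_le {ν : Measure Races} [IsProbabilityMeasure ν]
    {F : ℕ → Races → ℝ} {a : ℝ} (hF : ∀ n, Integrable (F n) ν) {b : ℕ → Races → ℝ}
    (hb : ∀ n, Integrable (b n) ν) (hab : ∀ n : ℕ, 1 ≤ n → ∀ ω, |F n ω - a| ≤ b n ω) {e : ℕ → ℝ}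
    (he : ∀ n : ℕ, 1 ≤ n → ∫ ω, b n ω ∂ν ≤ e n) (h0 : Tendsto e atTop (𝓝 0)) :
    Tendsto (fun n => ∫ ω, F n ω ∂ν) atTop (𝓝 a) := by
  rw [tendsto_iff_norm_sub_tendsto_zero]
  refine squeeze_zero' (Eventually.of_forall fun _ => norm_nonneg _) ?_ h0
  filter_upwards [eventually_ge_atTop 1] with n hn
  have h1 : (∫ ω, F n ω ∂ν) - a = ∫ ω, (F n ω - a) ∂ν := by
    rw [integral_sub (hF n) (integrable_const _), integral_const]
    simp
  rw [h1, Real.norm_eq_abs]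
  refine abs_integral_le_integral_abs.trans ((integral_mono ?_ (hb n) (hab n hn)).trans (he n hn))
  exact ((hF n).sub (integrable_const _)).abs

/-- Since `A / (1 + B) ≤ 1`, the error is linear in the deviations of `A` and `B`, so the `L¹` law
suffices. -/
theorem abs_div_sub_div_le {A B δ a n : ℝ} (hA : 0 ≤ A) (hAB : A ≤ B) (hδ : 0 < δ) (hn : 0 < n) :
    |A / (1 + B) - a / δ| ≤ (1 + |B - n * δ| + |A - n * a|) / (n * δ) := by
  have hB : 0 < 1 + B := by linarith
  have h1 : A / (1 + B) - a / δ =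
      (A / (1 + B) * (n * δ - (1 + B)) + (A - n * a)) / (n * δ) := by
    field_simp
    ring
  rw [h1, abs_div, abs_of_pos (mul_pos hn hδ)]
  refine div_le_div_of_nonneg_right ((abs_add_le _ _).trans ?_) (mul_pos hn hδ).le
  have h2 : |A / (1 + B) * (n * δ - (1 + B))| ≤ 1 + |B - n * δ| := by
    rw [abs_mul, abs_of_nonneg (div_nonneg hA hB.le)]
    have h3 : A / (1 + B) ≤ 1 := (div_le_one hB).2 (by linarith)
    calc _ ≤ 1 * |n * δ - (1 + B)| := mul_le_mul_of_nonneg_right h3 (abs_nonneg _)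
      _ = |(B - n * δ) + 1| := by rw [one_mul, abs_sub_comm]; ring_nf
      _ ≤ |B - n * δ| + |1| := abs_add_le _ _
      _ = _ := by rw [abs_one, add_comm]
  linarith

/-- If `B ≥ δ n / 4`, the denominator has order `n` and the deviation of `B` controls the error.
Otherwise only the bound `n + 1 / δ` is available, and the product of the exponentials is at least
1. -/
theorem abs_div_sub_one_div_le {B δ n θ : ℝ} (hB : 0 ≤ B) (hδ : 0 < δ) (hn : 0 < n)
    (hθ : 0 < θ) :
    |n / (1 + B) - 1 / δ| ≤ (1 + |B - n * δ|) / (δ * (δ / 4 * n)) +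
      (n + 1 / δ) * Real.exp (θ * (δ / 4 * n)) * Real.exp (-θ * B) := by
  have hB1 : 0 < 1 + B := by linarith
  rcases le_total (δ / 4 * n) B with h | h
  · have h1 : n / (1 + B) - 1 / δ = (n * δ - (1 + B)) / (δ * (1 + B)) := by
      field_simp
    have h2 : |n * δ - (1 + B)| ≤ 1 + |B - n * δ| := by
      have := abs_le.1 (le_refl |B - n * δ|)
      rw [abs_le]; constructor <;> linarith
    refine le_add_of_le_of_nonneg ?_ (by positivity)
    rw [h1, abs_div, abs_of_pos (mul_pos hδ hB1)]
    exact div_le_div₀ (by positivity) h2 (by positivity)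
      (mul_le_mul_of_nonneg_left (by linarith) hδ.le)
  · refine le_add_of_nonneg_of_le (by positivity) ?_
    rw [mul_assoc, ← Real.exp_add]
    have h1 : 1 ≤ Real.exp (θ * (δ / 4 * n) + -θ * B) := by
      rw [Real.one_le_exp_iff]
      nlinarith
    have h2 : n / (1 + B) ≤ n := div_le_self hn.le (by linarith)
    have h3 : 0 < n / (1 + B) := by positivity
    have h4 : 0 < 1 / δ := by positivity
    have h5 : |n / (1 + B) - 1 / δ| ≤ n + 1 / δ := by
      rw [abs_le]; constructor <;> linarith
    exact h5.trans (le_mul_of_one_le_right (by positivity) h1)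

theorem tendsto_integral_pathSum_div
    (hσ : Feasible σ) (hpos : ∀ i, 0 < p i) (hp : ∑ w, p w = 1) (hlam : 0 < lam)
    {π : StateSpace σ → ℝ} (hπ : IsStationary σ p π) (g : StateSpace σ → Fin 2 → ℝ) {f : StateSpace σ → ℝ}
    (hf : ∀ m, ∑ w, p w * g m w = f m) (m : StateSpace σ) :
    Tendsto (fun n : ℕ => ∫ ω, pathSum σ g m n ω / n ∂(raceLaw p lam)) atTop
      (𝓝 (π ⬝ᵥ f)) := by
  have := isProbabilityMeasure_raceLaw hpos hp hlam
  obtain ⟨C, hC⟩ := exists_integral_abs_pathSum_sub_le hσ hpos hp hlam hπ g hf m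
  have hS := dependsOnWinners_pathSum g m
  refine tendsto_integral_of_abs_sub_le (fun n => ((hS n).comp fun a => a / n).integrable)
    (b := fun n ω => |pathSum σ g m n ω - n * (π ⬝ᵥ f)| / n)
    (fun n => ((hS n).comp fun a => |a - n * (π ⬝ᵥ f)| / n).integrable) (fun n hn ω => ?_)
    (fun n hn => ?_) (tendsto_const_mul_inv_sqrt C)
  · have hn0 : (0 : ℝ) < n := by exact_mod_cast hn
    rw [div_sub' hn0.ne', abs_div, abs_of_pos hn0]
  · have hn0 : (0 : ℝ) < n := by exact_mod_cast hn
    rw [integral_div]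
    refine (div_le_div_of_nonneg_right (hC n hn) hn0.le).trans_eq ?_
    rw [mul_div_assoc, Real.sqrt_div_self', one_div]

theorem tendsto_integral_reward_ratio
    (hσ : Feasible σ) (hpos : ∀ i, 0 < p i) (hp : ∑ w, p w = 1) (hlam : 0 < lam)
    {π : StateSpace σ → ℝ} (hπ : IsStationary σ p π) (i : Fin 2) (m : StateSpace σ) :
    Tendsto (fun n : ℕ => ∫ ω, pathSum σ (reward σ i) m n ω /
      (1 + pathSum σ (totalReward σ) m n ω) ∂(raceLaw p lam)) atTop
      (𝓝 ((π ⬝ᵥ rhat σ p i) / (π ⬝ᵥ (rhat σ p 0 + rhat σ p 1)))) := by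
  have := isProbabilityMeasure_raceLaw hpos hp hlam
  have hδ := dotProduct_rhat_pos hσ hpos hπ
  set δ := π ⬝ᵥ (rhat σ p 0 + rhat σ p 1)
  set a := π ⬝ᵥ rhat σ p i
  obtain ⟨C, hC⟩ := exists_integral_abs_pathSum_sub_le hσ hpos hp hlam hπ (reward σ i)
    (sum_mul_reward i) m
  obtain ⟨C', hC'⟩ := exists_integral_abs_pathSum_sub_le hσ hpos hp hlam hπ (totalReward σ)
    sum_mul_totalReward m
  have hA := dependsOnWinners_pathSum (reward σ i) m
  have hB := dependsOnWinners_pathSum (totalReward σ) m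
  refine tendsto_integral_of_abs_sub_le
    (fun n => ((hA n).comp₂ (hB n) fun a b => a / (1 + b)).integrable)
    (b := fun (n : ℕ) ω => (1 + |pathSum σ (totalReward σ) m n ω - n * δ| +
      |pathSum σ (reward σ i) m n ω - n * a|) / (n * δ))
    (fun n => ((hA n).comp₂ (hB n) fun x y =>
      (1 + |y - n * δ| + |x - n * a|) / (n * δ)).integrable)
    (fun n hn ω => abs_div_sub_div_le (pathSum_reward_nonneg hσ i m n ω)
      (pathSum_reward_le hσ i m n ω) hδ (by exact_mod_cast hn))
    (fun n hn => ?_) (tendsto_const_mul_inv_sqrt ((1 + C' + C) / δ))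
  have hn0 : (0 : ℝ) < n := by exact_mod_cast hn
  have hn1 : (1 : ℝ) ≤ √n := Real.one_le_sqrt.2 (by exact_mod_cast hn)
  have i1 := ((hA n).comp fun x => |x - n * a|).integrable (p := p) (lam := lam)
  have i2 := ((hB n).comp fun x => |x - n * δ|).integrable (p := p) (lam := lam)
  have i3 := (integrable_const (μ := raceLaw p lam) (1 : ℝ))
  have i4 := ((hB n).comp fun x => 1 + |x - n * δ|).integrable (p := p) (lam := lam)
  rw [integral_div, integral_add i4 i1, integral_add i3 i2, integral_const]
  simp only [probReal_univ, one_smul]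
  calc _ ≤ ((1 + C' + C) * √n) / (n * δ) := by
        refine div_le_div_of_nonneg_right ?_ (mul_pos hn0 hδ).le
        linarith [hC n hn, hC' n hn]
    _ = _ := by
        rw [mul_comm (n : ℝ), mul_div_mul_comm, Real.sqrt_div_self', one_div]

theorem tendsto_integral_inv_validated
    (hσ : Feasible σ) (hpos : ∀ i, 0 < p i) (hp : ∑ w, p w = 1) (hlam : 0 < lam)
    {π : StateSpace σ → ℝ} (hπ : IsStationary σ p π) (m : StateSpace σ) :
    Tendsto (fun n : ℕ => ∫ ω, n / (1 + pathSum σ (totalReward σ) m n ω) ∂(raceLaw p lam)) atTop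
      (𝓝 (1 / (π ⬝ᵥ (rhat σ p 0 + rhat σ p 1)))) := by
  have := isProbabilityMeasure_raceLaw hpos hp hlam
  have hδ := dotProduct_rhat_pos hσ hpos hπ
  set δ := π ⬝ᵥ (rhat σ p 0 + rhat σ p 1) with hδdef
  obtain ⟨C, hC⟩ := exists_integral_abs_pathSum_sub_le hσ hpos hp hlam hπ (totalReward σ)
    sum_mul_totalReward m
  obtain ⟨θ, C', hθ, hC'⟩ := exists_integral_exp_neg_pathSum_le hσ hpos hp hlam hπ
    (totalReward σ) sum_mul_totalReward hδ m
  have hB := dependsOnWinners_pathSum (totalReward σ) m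
  have hlim : Tendsto (fun n : ℕ => (1 + C) / (δ * (δ / 4)) * (√(n : ℝ))⁻¹ +
      C' * (((n : ℝ) + 1 / δ) * Real.exp (-(θ * δ / 4) * n))) atTop (𝓝 0) := by
    have hr : 0 < θ * δ / 4 := by positivity
    have e1 : Tendsto (fun x : ℝ => x ^ (1 : ℝ) * Real.exp (-(θ * δ / 4) * x)) atTop (𝓝 0) :=
      tendsto_rpow_mul_exp_neg_mul_atTop_nhds_zero 1 _ hr
    have e2 : Tendsto (fun x : ℝ => x ^ (0 : ℝ) * Real.exp (-(θ * δ / 4) * x)) atTop (𝓝 0) :=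
      tendsto_rpow_mul_exp_neg_mul_atTop_nhds_zero 0 _ hr
    have e3 := (e1.add (e2.const_mul (1 / δ))).comp tendsto_natCast_atTop_atTop (α := ℕ)
    have e4 := (tendsto_const_mul_inv_sqrt ((1 + C) / (δ * (δ / 4)))).add (e3.const_mul C')
    simp only [mul_zero, add_zero] at e4
    refine e4.congr fun n => ?_
    simp only [Function.comp, Real.rpow_one, Real.rpow_zero]
    ring
  refine tendsto_integral_of_abs_sub_le
    (fun n => ((hB n).comp fun b => n / (1 + b)).integrable)
    (b := fun (n : ℕ) ω => (1 + |pathSum σ (totalReward σ) m n ω - n * δ|) / (δ * (δ / 4 * n)) +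
      (n + 1 / δ) * Real.exp (θ * (δ / 4 * n)) *
        Real.exp (-θ * pathSum σ (totalReward σ) m n ω))
    (fun n => ((hB n).comp fun y => (1 + |y - n * δ|) / (δ * (δ / 4 * n)) +
      (n + 1 / δ) * Real.exp (θ * (δ / 4 * n)) * Real.exp (-θ * y)).integrable)
    (fun n hn ω => abs_div_sub_one_div_le (pathSum_totalReward_nonneg hσ m n ω)
      hδ (by exact_mod_cast hn) hθ)
    (fun n hn => ?_) hlim
  have hn0 : (0 : ℝ) < n := by exact_mod_cast hn
  have hn1 : (1 : ℝ) ≤ √n := Real.one_le_sqrt.2 (by exact_mod_cast hn)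
  have i1 := ((hB n).comp fun x => |x - n * δ|).integrable (p := p) (lam := lam)
  have i2 := ((hB n).comp fun x => Real.exp (-θ * x)).integrable (p := p) (lam := lam)
  have i3 := (integrable_const (μ := raceLaw p lam) (1 : ℝ))
  have i4 := ((hB n).comp fun x => (1 + |x - n * δ|) / (δ * (δ / 4 * n))).integrable
    (p := p) (lam := lam)
  rw [integral_add i4 (i2.const_mul _), integral_div, integral_add i3 i1,
    integral_const, integral_const_mul]
  simp only [probReal_univ, one_smul]
  refine add_le_add ?_ ?_
  · calc _ ≤ ((1 + C) * √n) / (δ * (δ / 4) * n) := by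
          rw [mul_assoc δ]
          refine div_le_div_of_nonneg_right ?_ (by positivity)
          linarith [hC n hn]
      _ = _ := by
          rw [mul_div_mul_comm, Real.sqrt_div_self', one_div]
  · refine (mul_le_mul_of_nonneg_left (hC' n) (by positivity)).trans_eq ?_
    -- The threshold `δ / 4` lies below the decay rate `δ / 2` of the exponential moment, so `exp
    -- (-(θ * δ / 4) * n)` remains and beats the factor `n + 1 / δ`.
    have : Real.exp (-(θ * δ / 4) * n) =
        Real.exp (θ * (δ / 4 * n)) * Real.exp (-(θ * δ / 2 * n)) := by
      rw [← Real.exp_add]; ring_nf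
    rw [this]
    ring

/-! ### Turn lengths and averaging over the initial state -/

/-- The mean of the exponential distribution. -/
noncomputable def meanLength (lam : ℝ) : ℝ := ∫ t, t ∂(expMeasure lam)

/-- `F` may depend on the winner of race `k` itself. Passing that winner as a parameter leaves a
function of the other races, as `integral_mul_length` requires. -/
theorem integral_length_mul (hpos : ∀ i, 0 < p i) (hp : ∑ w, p w = 1) (hlam : 0 < lam)
    {S : Finset ℕ} {F : Races → ℝ} (hF : DependsOnWinners S F) (k : ℕ) :
    Integrable (fun ω => F ω * (ω k).2) (raceLaw p lam) ∧
    ∫ ω, F ω * (ω k).2 ∂(raceLaw p lam) = (∫ ω, F ω ∂(raceLaw p lam)) * meanLength lam := by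
  classical
  have hG : ∀ w, DependsOnWinners (S.erase k) fun ω => F (Function.update ω k (w, 0)) := by
    intro w ω ω' h
    refine hF _ _ fun j hj => ?_
    by_cases hjk : j = k
    · subst hjk; simp
    · simp [hjk, h j (Finset.mem_erase.2 ⟨hjk, hj⟩)]
  have hFG : ∀ ω : Races, F (Function.update ω k ((ω k).1, 0)) = F ω := by
    intro ω
    refine hF _ _ fun j _ => ?_
    by_cases hjk : j = k
    · subst hjk; simp
    · simp [hjk]
  have h1 := integral_mul_length hpos hp hlam (Finset.notMem_erase k S) _ hG
    (integrable_id_expMeasure hlam) measurable_id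
  have h2 := integral_winner hpos hp hlam (Finset.notMem_erase k S) _ hG
  simp only [hFG] at h1 h2
  exact ⟨h1.1, by rw [h1.2, h2]; rfl⟩

/-- The state space is finite, so measurability and integrability for each initial state suffice,
and limits common to all initial states pass to every `μ`. -/
theorem integral_gameLaw {μ : Measure (StateSpace σ)} [IsProbabilityMeasure μ]
    [IsProbabilityMeasure (raceLaw p lam)] {F : StateSpace σ × Races → ℝ}
    (hm : ∀ m, Measurable fun ω => F (m, ω))
    (hi : ∀ m, Integrable (fun ω => F (m, ω)) (raceLaw p lam)) :
    ∫ x, F x ∂(gameLaw σ p lam μ) = ∑ m, μ.real {m} * ∫ ω, F (m, ω) ∂(raceLaw p lam) := by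
  have hF : Integrable F (μ.prod (raceLaw p lam)) :=
    (integrable_prod_iff (measurable_from_prod_countable_right hm).aestronglyMeasurable).2
      ⟨ae_of_all _ hi, Integrable.of_finite⟩
  rw [gameLaw, integral_prod F hF, integral_fintype Integrable.of_finite]
  rfl

theorem tendsto_integral_gameLaw (μ : Measure (StateSpace σ)) [IsProbabilityMeasure μ]
    [IsProbabilityMeasure (raceLaw p lam)] {F : ℕ → StateSpace σ × Races → ℝ} {a : ℝ}
    (hm : ∀ n m, Measurable fun ω => F n (m, ω))
    (hi : ∀ n m, Integrable (fun ω => F n (m, ω)) (raceLaw p lam))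
    (h : ∀ m, Tendsto (fun n => ∫ ω, F n (m, ω) ∂(raceLaw p lam)) atTop (𝓝 a)) :
    Tendsto (fun n => ∫ x, F n x ∂(gameLaw σ p lam μ)) atTop (𝓝 a) := by
  simp only [integral_gameLaw (hm _) (hi _)]
  have h1 : ∑ m, μ.real {m} * a = a := by
    rw [← Finset.sum_mul, sum_measureReal_singleton, Finset.coe_univ, probReal_univ, one_mul]
  have h2 := tendsto_finsetSum Finset.univ fun m _ => (h m).const_mul (μ.real {m})
  rwa [h1] at h2

/-! ### The asymptotic quantities of the game -/

theorem sum_Icc_validated (m : StateSpace σ) (n : ℕ) (ω : Races) :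
    ∑ k ∈ Finset.Icc 1 n, validated σ k (m, ω) =
      pathSum σ (totalReward σ) m (n + 1) ω - totalReward σ m (ω 0).1 := by
  induction n with
  | zero => simp [pathSum, X]
  | succ n ih =>
    rw [Finset.sum_Icc_succ_top (by omega), ih, pathSum_succ _ _ (n + 1)]
    change _ + totalReward σ (X σ (n + 1) (m, ω)) (ω (n + 1)).1 = _
    ring

theorem isValidationRate
    (hσ : Feasible σ) (hpos : ∀ i, 0 < p i) (hp : ∑ w, p w = 1) (hlam : 0 < lam)
    {π : StateSpace σ → ℝ} (hπ : IsStationary σ p π) (μ : Measure (StateSpace σ))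
    [IsProbabilityMeasure μ] :
    IsValidationRate σ p lam μ (π ⬝ᵥ (rhat σ p 0 + rhat σ p 1)) := by
  have := isProbabilityMeasure_raceLaw hpos hp hlam
  unfold IsValidationRate
  simp only [← integral_const_mul]
  have hF : ∀ (n : ℕ) (m : StateSpace σ), DependsOnWinners (Finset.range (n + 1)) fun ω =>
      1 / (n : ℝ) * (1 + ∑ k ∈ Finset.Icc 1 n, validated σ k (m, ω)) := by
    intro n m ω ω' h
    simp only [sum_Icc_validated]
    rw [dependsOnWinners_pathSum _ m (n + 1) ω ω' h, h 0 (by simp)]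
  refine tendsto_integral_gameLaw μ (fun n m => (hF n m).measurable)
    (fun n m => (hF n m).integrable) fun m => ?_
  simp only [sum_Icc_validated]
  have h1 := (tendsto_integral_pathSum_div hσ hpos hp hlam hπ (totalReward σ)
    sum_mul_totalReward m).comp (tendsto_add_atTop_nat 1)
  have h0 : Tendsto (fun n : ℕ => 1 / (n : ℝ)) atTop (𝓝 0) := tendsto_one_div_atTop_nhds_zero_nat
  set c := ∫ ω, totalReward σ m (ω 0).1 ∂(raceLaw p lam)
  -- The sum over turns `1, …, n` is the path sum of length `n + 1` without turn 0; hence the factor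
  -- `1 + 1 / n` and the correction `(1 - c) / n`.
  have h2 := (((h0.const_add 1).mul h1).add (h0.mul_const (1 - c)))
  simp only [add_zero, one_mul, zero_mul] at h2
  refine h2.congr' ?_
  filter_upwards [eventually_ge_atTop 1] with n hn
  have hn0 : (n : ℝ) ≠ 0 := by positivity
  have hn1 : (n : ℝ) + 1 ≠ 0 := by positivity
  have i1 := (dependsOnWinners_pathSum (totalReward σ) m (n + 1)).integrable
    (p := p) (lam := lam)
  have i2 : Integrable (fun ω : Races => totalReward σ m (ω 0).1) (raceLaw p lam) :=
    DependsOnWinners.integrable (S := {0}) fun ω ω' h => by rw [h 0 (by simp)]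
  have i3 : Integrable (fun ω => pathSum σ (totalReward σ) m (n + 1) ω - totalReward σ m (ω 0).1)
      (raceLaw p lam) := i1.sub i2
  rw [integral_const_mul, integral_add (integrable_const _) i3, integral_sub i1 i2,
    integral_const]
  simp only [Function.comp, integral_div, probReal_univ, one_smul, Nat.cast_add, Nat.cast_one]
  field_simp
  ring

theorem isBlockRatio
    (hσ : Feasible σ) (hpos : ∀ i, 0 < p i) (hp : ∑ w, p w = 1) (hlam : 0 < lam)
    {π : StateSpace σ → ℝ} (hπ : IsStationary σ p π) (μ : Measure (StateSpace σ))
    [IsProbabilityMeasure μ] (i : Fin 2) :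
    IsBlockRatio σ p lam μ i
      ((π ⬝ᵥ rhat σ p i) / (π ⬝ᵥ (rhat σ p 0 + rhat σ p 1))) := by
  have := isProbabilityMeasure_raceLaw hpos hp hlam
  have hF : ∀ (n : ℕ) (m : StateSpace σ), DependsOnWinners (Finset.range n) fun ω =>
      pathSum σ (reward σ i) m n ω / (1 + pathSum σ (totalReward σ) m n ω) := fun n m =>
    (dependsOnWinners_pathSum _ m n).comp₂ (dependsOnWinners_pathSum _ m n)
      fun a b => a / (1 + b)
  exact tendsto_integral_gameLaw μ (fun n m => (hF n m).measurable)
    (fun n m => (hF n m).integrable) fun m =>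
      tendsto_integral_reward_ratio hσ hpos hp hlam hπ i m

/-- This limit exists for every rate `lam`, so a target `τbar` can only be this value. -/
theorem difficultyAdjusted
    (hσ : Feasible σ) (hpos : ∀ i, 0 < p i) (hp : ∑ w, p w = 1) (hlam : 0 < lam)
    {π : StateSpace σ → ℝ} (hπ : IsStationary σ p π) (μ : Measure (StateSpace σ))
    [IsProbabilityMeasure μ] :
    DifficultyAdjusted σ p lam μ (meanLength lam / (π ⬝ᵥ (rhat σ p 0 + rhat σ p 1))) := by
  have := isProbabilityMeasure_raceLaw hpos hp hlam
  have hE : ∀ (n : ℕ) (m : StateSpace σ) (ω : Races),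
      (∑ k ∈ Finset.range n, turnLength σ k (m, ω)) /
        (1 + ∑ k ∈ Finset.range n, validated σ k (m, ω)) =
      ∑ k ∈ Finset.range n, (1 + pathSum σ (totalReward σ) m n ω)⁻¹ * (ω k).2 := by
    intro n m ω
    rw [← Finset.mul_sum, div_eq_inv_mul]
    rfl
  have hF : ∀ (n : ℕ) (m : StateSpace σ), DependsOnWinners (Finset.range n) fun ω =>
      (1 + pathSum σ (totalReward σ) m n ω)⁻¹ := fun n m =>
    (dependsOnWinners_pathSum _ m n).comp fun b => (1 + b)⁻¹
  have hI : ∀ n m k, Integrable (fun ω : Races =>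
      (1 + pathSum σ (totalReward σ) m n ω)⁻¹ * (ω k).2) (raceLaw p lam) := fun n m k =>
    (integral_length_mul hpos hp hlam (hF n m) k).1
  refine tendsto_integral_gameLaw μ (fun n m => ?_) (fun n m => ?_) fun m => ?_
  · simp only [hE]
    have := (hF n m).measurable
    fun_prop
  · simp only [hE]
    exact integrable_finsetSum _ fun k _ => hI n m k
  · simp only [hE]
    have h1 := (tendsto_integral_inv_validated hσ hpos hp hlam hπ m).const_mul (meanLength lam)
    rw [mul_one_div] at h1
    refine h1.congr fun n => ?_
    rw [integral_finsetSum _ fun k _ => hI n m k]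
    simp only [(integral_length_mul hpos hp hlam (hF n m) _).2, Finset.sum_const,
      Finset.card_range, nsmul_eq_mul, div_eq_mul_inv, integral_const_mul]
    ring

theorem isRevenue
    (hσ : Feasible σ) (hpos : ∀ i, 0 < p i) (hp : ∑ w, p w = 1) (hlam : 0 < lam)
    {π : StateSpace σ → ℝ} (hπ : IsStationary σ p π) (μ : Measure (StateSpace σ))
    [IsProbabilityMeasure μ] (ci : ℝ) (i : Fin 2) :
    IsRevenue σ p lam μ ci i (π ⬝ᵥ rhat σ p i - ci * meanLength lam) := by
  have := isProbabilityMeasure_raceLaw hpos hp hlam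
  unfold IsRevenue
  simp only [← integral_const_mul]
  have hE : ∀ (n : ℕ) (m : StateSpace σ) (ω : Races),
      1 / (n : ℝ) * ∑ k ∈ Finset.range n, (blocks σ i k (m, ω) - ci * turnLength σ k (m, ω)) =
      pathSum σ (reward σ i) m n ω / n - ∑ k ∈ Finset.range n, ci / n * (ω k).2 := by
    intro n m ω
    rw [Finset.sum_sub_distrib, ← Finset.mul_sum, ← Finset.mul_sum]
    simp only [pathSum, blocks, turnLength]
    ring
  have hF : ∀ (n : ℕ) (m : StateSpace σ), DependsOnWinners (Finset.range n) fun ω =>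
      pathSum σ (reward σ i) m n ω / n := fun n m =>
    (dependsOnWinners_pathSum _ m n).comp fun b => b / n
  have hc : ∀ c : ℝ, DependsOnWinners ∅ fun _ : Races => c := fun _ _ _ _ => rfl
  have hT : ∀ c k, Integrable (fun ω : Races => c * (ω k).2) (raceLaw p lam) := fun c k =>
    (integral_length_mul hpos hp hlam (hc c) k).1
  have hTs : ∀ n : ℕ, Integrable (fun ω : Races => ∑ k ∈ Finset.range n, ci / n * (ω k).2)
      (raceLaw p lam) := fun n => integrable_finsetSum _ fun k _ => hT _ k
  refine tendsto_integral_gameLaw μ (fun n m => ?_) (fun n m => ?_) fun m => ?_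
  · simp only [hE]
    have := (hF n m).measurable
    fun_prop
  · simp only [hE]
    exact (hF n m).integrable.sub (hTs n)
  · simp only [hE]
    refine ((tendsto_integral_pathSum_div hσ hpos hp hlam hπ (reward σ i)
      (sum_mul_reward i) m).sub_const (ci * meanLength lam)).congr' ?_
    filter_upwards [eventually_ge_atTop 1] with n hn
    have hn0 : (n : ℝ) ≠ 0 := by positivity
    rw [integral_sub (hF n m).integrable (hTs n), integral_finsetSum _ fun k _ => hT _ k]
    simp only [(integral_length_mul hpos hp hlam (hc _) _).2, Finset.sum_const,
      Finset.card_range, nsmul_eq_mul, integral_const, probReal_univ, one_smul]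
    field_simp

end MiningGame

theorem mainTheorem3 {d : ℕ} (σ : Fin 2 → MiningGame.CapitulationPolicy d)
    (hσ : MiningGame.Feasible σ)
    (p : Fin 2 → ℝ) (hp_pos : ∀ i, 0 < p i) (hp_sum : p 0 + p 1 = 1)
    (lam : ℝ) (hlam : 0 < lam) :
    (∃! π : MiningGame.StateSpace σ → ℝ, MiningGame.IsStationary σ p π) ∧
    ∀ π : MiningGame.StateSpace σ → ℝ, MiningGame.IsStationary σ p π →
    ∀ (μ : Measure (MiningGame.StateSpace σ)) [IsProbabilityMeasure μ],
    ∃ δ : ℝ, ∃ G : Fin 2 → ℝ,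
      MiningGame.IsValidationRate σ p lam μ δ ∧
      (∀ i, MiningGame.IsBlockRatio σ p lam μ i (G i)) ∧
      0 < δ ∧
      δ = π ⬝ᵥ (MiningGame.rhat σ p 0 + MiningGame.rhat σ p 1) ∧
      (∀ i, G i = (π ⬝ᵥ MiningGame.rhat σ p i) / δ) ∧
      ∀ (c : Fin 2 → ℝ), (∀ i, 0 ≤ c i) →
      ∀ (τbar : ℝ), MiningGame.DifficultyAdjusted σ p lam μ τbar →
        ∀ i, ∃ R : ℝ, MiningGame.IsRevenue σ p lam μ (c i) i R ∧
          R = δ * (G i - c i * τbar) ∧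
          R = π ⬝ᵥ MiningGame.rhat σ p i - c i * τbar * δ := by
  have hp : ∑ w, p w = 1 := by rw [Fin.sum_univ_two, hp_sum]
  refine ⟨?_, fun π hπ μ _ => ?_⟩
  · obtain ⟨π, hπ⟩ := MiningGame.exists_isStationary (σ := σ) hp_pos hp
    exact ⟨π, hπ, fun π' hπ' => hπ.eq hσ hp_pos hp hπ'⟩
  · have hδ := MiningGame.dotProduct_rhat_pos hσ hp_pos hπ
    refine ⟨_, _, MiningGame.isValidationRate hσ hp_pos hp hlam hπ μ,
      MiningGame.isBlockRatio hσ hp_pos hp hlam hπ μ, hδ, rfl, fun _ => rfl,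
      fun c _ τbar hτ i => ⟨_, MiningGame.isRevenue hσ hp_pos hp hlam hπ μ (c i) i, ?_⟩⟩
    -- With `τbar` replaced by the mean length over `δ`, both formulas for `R` are algebra.
    rw [tendsto_nhds_unique hτ (MiningGame.difficultyAdjusted hσ hp_pos hp hlam hπ μ)]
    constructor
    · field_simp
    · rw [mul_assoc, div_mul_cancel₀ _ hδ.ne']
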